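/- Let $(W,S)$, $S=\{s_1,\dots,s_n\}$ (Bourbaki numbering), be a Coxeter system and $J=S\setminus\{s_m\}$, in one of the following Hermitian symmetric cases. In each case we give the diagram of the type: a set of boxes $(i,j)$ (row $i\ge 0$ counted downwards, column $j\ge 0$ counted to the right) in which every box carries the number $k$ of a generator $s_k$. * $A_n/(A_{p-1}\times A_{n-p})$, $1\le p\le n$, $m=p$: boxes $0\le i\le n-p$, $0\le j<p$, label $p+i-j$. * $C_n/A_{n-1}$, $n\ge2$, $m=n$: boxes $0\le i\le j<n$, label $n+i-j$. * $B_n/B_{n-1}$, $n\ge 2$, $m=1$: row $0$ is $1,2,\dots,n$ in columns $0,\dots,n-1$; column $n-1$ continues downwards with $n-1,n-2,\dots,1$. * $D_n/A_{n-1}$, $n\ge3$, $m=n$: boxes $0\le i\le j\le n-2$; label $n-1+i-j$ if $i<j$; label $n$ if $i=j$ is even, and $n-1$ if $i=j$ is odd. * $D_n/D_{n-1}$, $n\ge3$, $m=1$: row $0$ is $1,2,\dots,n-2,n$ in columns $0,\dots,n-2$; row $1$ is $n-1,n-2$ in columns $n-3,n-2$; column $n-2$ continues downwards with $n-3,\dots,1$.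 * $E_6/D_5$, $m=1$: rows $(1,3,4,5,6)$, $(2,4,5)$, $(3,4,2)$, $(1,3,4,5,6)$ starting in columns $0,2,3,3$. * $E_7/E_6$, $m=7$: rows $(7,6,5,4,3,1)$, $(2,4,3)$, $(5,4,2)$, $(6,5,4,3,1)$, $(7,6,5,4,3)$, $(2,4)$, $(5)$, $(6)$, $(7)$ starting in columns $0,3,4,4,4,7,8,8,8$. Let $\ell$ be the length function, let $W^J=\{w\in W:\ell(ws)>\ell(w)\text{ for all }s\in J\}$ be the set of minimal length representatives of the cosets $wW_J$, and call $s\in S$ a left descent of $w$ if $\ell(sw)<\ell(w)$. A subdiagram is a subset $\Lambda$ of the diagram that contains, with a box $b$, every box of the diagram lying weakly above and weakly to the left of $b$. The subdiagram $\Lambda$ is the diagram of $w\in W^J$ if $w=r_k^{-1}\cdots r_2^{-1}r_1^{-1}$, where $r_1,\dots,r_k$ are the products of the labels in the rows of $\Lambda$, rows taken from top to bottom and each row read from left to right. An outside corner of $\Lambda$ is a box of $\Lambda$ such that $\Lambda$ has no box immediately to the right of it and none immediately below it. Let $u\in W^J$ have diagram $\Lambda$, let $s\in S$, and suppose that $su\in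 W^J$ has diagram $M$. Then $s$ is a left descent of $u$ if and only if $\Lambda\setminus M$ consists of a single box, and this box is an outside corner of $\Lambda$. If $s$ is not a left descent of $u$, then $M\setminus\Lambda$ consists of a single box, and this box is an outside corner of $M$. -/

import Mathlib

/-- The Hermitian symmetric pairs `(W, J)`, with the generators numbered `s_1, …, s_n` as in
Bourbaki. -/
inductive HermitianType : Type
  /-- `A_n / (A_{p-1} × A_{n-p})`, where `J` omits `s_p`. -/
  | A (n p : ℕ) (hp : 1 ≤ p) (hpn : p ≤ n)
  /-- `C_n / A_{n-1}`, where `J` omits `s_n`. -/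
  | C (n : ℕ) (hn : 2 ≤ n)
  /-- `B_n / B_{n-1}`, where `J` omits `s_1`. -/
  | B (n : ℕ) (hn : 2 ≤ n)
  /-- `D_n / A_{n-1}`, where `J` omits `s_n`. -/
  | DA (n : ℕ) (hn : 3 ≤ n)
  /-- `D_n / D_{n-1}`, where `J` omits `s_1`. -/
  | DD (n : ℕ) (hn : 3 ≤ n)
  /-- `E_6 / D_5`, where `J` omits `s_1`. -/
  | E6
  /-- `E_7 / E_6`, where `J` omits `s_7`. -/
  | E7

/-- The Coxeter matrix of type `D_n`: the nodes `0, …, n-2` form a path and the node `n-1` is joined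
to `n-3`. (Mathlib's `CoxeterMatrix.D` also joins `n-1` to `n-2`, so it is not used.) -/
def coxeterMatrixD (n : ℕ) : CoxeterMatrix (Fin n) where
  M := Matrix.of fun i j : Fin n ↦
    if i = j then 1
    else if ((i : ℕ) + 1 = j ∧ (j : ℕ) + 1 < n) ∨ ((j : ℕ) + 1 = i ∧ (i : ℕ) + 1 < n)
        ∨ ((i : ℕ) + 2 = j ∧ (j : ℕ) + 1 = n) ∨ ((j : ℕ) + 2 = i ∧ (i : ℕ) + 1 = n) then 3
    else 2
  isSymm := by
    ext i j
    simp only [Matrix.transpose_apply, Matrix.of_apply]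
    congr 1
    · simp only [eq_comm]
    · congr 1
      simp only [eq_iff_iff]
      tauto
  diagonal := by simp
  off_diagonal := by
    intro i j h
    simp only [Matrix.of_apply, if_neg h]
    split_ifs <;> decide

namespace HermitianType

/-- The number of simple reflections of `W`. -/
def rank : HermitianType → ℕ
  | A n _ _ _ => n
  | C n _ => n
  | B n _ => n
  | DA n _ => n
  | DD n _ => n
  | E6 => 6
  | E7 => 7

instance (t : HermitianType) : NeZero t.rank := ⟨by cases t <;> simp only [rank] <;> omega⟩

/-- The Coxeter matrix of `W`; the index `i : Fin n` stands for the generator `s_{i+1}`. -/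
def coxeterMatrix : (t : HermitianType) → CoxeterMatrix (Fin t.rank)
  | A n _ _ _ => CoxeterMatrix.A n
  | C n _ => CoxeterMatrix.B n
  | B n _ => CoxeterMatrix.B n
  | DA n _ => coxeterMatrixD n
  | DD n _ => coxeterMatrixD n
  | E6 => CoxeterMatrix.E₆
  | E7 => CoxeterMatrix.E₇

/-- The number of the one generator that is not in `J`. -/
def omitted : HermitianType → ℕ
  | A _ p _ _ => p
  | C n _ => n
  | B _ _ => 1
  | DA n _ => n
  | DD _ _ => 1
  | E6 => 1
  | E7 => 7

/-- The set `J` of generators of the parabolic subgroup. -/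
def J (t : HermitianType) : Set (Fin t.rank) := {i | (i : ℕ) + 1 ≠ t.omitted}

/-- The diagram of `E_6 / D_5`, with `0` for a blank. -/
def tableE6 : List (List ℕ) :=
  [[1, 3, 4, 5, 6],
   [0, 0, 2, 4, 5],
   [0, 0, 0, 3, 4, 2],
   [0, 0, 0, 1, 3, 4, 5, 6]]

/-- The diagram of `E_7 / E_6`, with `0` for a blank. -/
def tableE7 : List (List ℕ) :=
  [[7, 6, 5, 4, 3, 1],
   [0, 0, 0, 2, 4, 3],
   [0, 0, 0, 0, 5, 4, 2],
   [0, 0, 0, 0, 6, 5, 4, 3, 1],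
   [0, 0, 0, 0, 7, 6, 5, 4, 3],
   [0, 0, 0, 0, 0, 0, 0, 2, 4],
   [0, 0, 0, 0, 0, 0, 0, 0, 5],
   [0, 0, 0, 0, 0, 0, 0, 0, 6],
   [0, 0, 0, 0, 0, 0, 0, 0, 7]]

/-- The number `k` of the generator `s_k` written in the box `b = (row, column)` of the diagram of
the given type. Rows are counted downwards and columns to the right, both from `0`. The value is
used for the boxes in `boxes` only. -/
def label : HermitianType → ℕ × ℕ → ℕ
  | A _ p _ _, b => p + b.1 - b.2
  | C n _, b => n + b.1 - b.2
  | B n _, b => if b.1 = 0 then b.2 + 1 else n - b.1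
  | DA n _, b =>
      if b.1 = b.2 then (if b.1 % 2 = 0 then n else n - 1) else n - 1 + b.1 - b.2
  | DD n _, b =>
      if b.1 = 0 then (if b.2 = n - 2 then n else b.2 + 1)
      else if b.2 = n - 3 then n - 1
      else n - 1 - b.1
  | E6, b => (tableE6.getD b.1 []).getD b.2 0
  | E7, b => (tableE7.getD b.1 []).getD b.2 0

/-- The set of boxes of the (full) diagram of the given type. -/
def boxes : HermitianType → Finset (ℕ × ℕ)
  | A n p _ _ => Finset.range (n + 1 - p) ×ˢ Finset.range p
  | C n _ => (Finset.range n ×ˢ Finset.range n).filter fun b => b.1 ≤ b.2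
  | B n _ => (Finset.range n ×ˢ Finset.range n).filter fun b => b.1 = 0 ∨ b.2 = n - 1
  | DA n _ => (Finset.range (n - 1) ×ˢ Finset.range (n - 1)).filter fun b => b.1 ≤ b.2
  | DD n _ => (Finset.range (n - 1) ×ˢ Finset.range (n - 1)).filter fun b =>
      b.1 = 0 ∨ b.2 = n - 2 ∨ b = (1, n - 3)
  | E6 => (Finset.range 4 ×ˢ Finset.range 8).filter fun b => E6.label b ≠ 0
  | E7 => (Finset.range 9 ×ˢ Finset.range 9).filter fun b => E7.label b ≠ 0

/-- The labels in a diagram are numbers of generators. -/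
theorem label_mem_Icc (t : HermitianType) (b : ℕ × ℕ) (hb : b ∈ t.boxes) :
    1 ≤ t.label b ∧ t.label b ≤ t.rank := by
  obtain ⟨i, j⟩ := b
  cases t with
  | E6 => revert hb; generalize (i, j) = b; revert b; decide
  | E7 =>
    set_option maxRecDepth 10000 in
    revert hb; generalize (i, j) = b; revert b; decide
  | _ =>
    simp only [boxes, Finset.mem_filter, Finset.mem_product, Finset.mem_range, Prod.mk.injEq]
      at hb
    simp only [label, rank]
    (try split_ifs) <;> omega

/-- The generator, as an index in `Fin n`, written in the box `b`. -/
def gen (t : HermitianType) (b : ℕ × ℕ) : Fin t.rank := Fin.ofNat t.rank (t.label b - 1)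

/-- For a box of the diagram, `gen` is the generator whose number is the label of the box. -/
theorem gen_val_add_one (t : HermitianType) (b : ℕ × ℕ) (hb : b ∈ t.boxes) :
    (t.gen b : ℕ) + 1 = t.label b := by
  obtain ⟨h1, h2⟩ := t.label_mem_Icc b hb
  rw [gen, Fin.val_ofNat, Nat.mod_eq_of_lt (by omega)]
  omega

/-- A subdiagram: a set of boxes of the diagram that contains, with a box `b`, every box of the
diagram that lies (weakly) above and to the left of `b`. -/
def IsSubdiagram (t : HermitianType) (Λ : Finset (ℕ × ℕ)) : Prop :=
  Λ ⊆ t.boxes ∧ ∀ b ∈ Λ, ∀ c ∈ t.boxes, c.1 ≤ b.1 → c.2 ≤ b.2 → c ∈ Λ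

/-- The word in the generators that is read off the rows of `Λ`, from the top row to the bottom
row, and from left to right in each row. (No diagram has more than `rank + 2` rows or columns.) -/
def rowWord (t : HermitianType) (Λ : Finset (ℕ × ℕ)) : List (Fin t.rank) :=
  (List.range (t.rank + 2)).flatMap fun i =>
    ((List.range (t.rank + 2)).filter fun j => (i, j) ∈ Λ).map fun j => t.gen (i, j)

/-- `rowWord` misses no box of the diagram. -/
theorem lt_of_mem_boxes (t : HermitianType) (b : ℕ × ℕ) (hb : b ∈ t.boxes) :
    b.1 < t.rank + 2 ∧ b.2 < t.rank + 2 := by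
  obtain ⟨i, j⟩ := b
  cases t <;>
    simp only [boxes, Finset.mem_filter, Finset.mem_product, Finset.mem_range] at hb <;>
    simp only [rank] <;> omega

variable {W : Type*} [Group W]

/-- `W^J`, the set of minimal length representatives of the cosets `w W_J`. -/
def minReps (t : HermitianType) (cs : CoxeterSystem t.coxeterMatrix W) : Set W :=
  {w | ∀ j ∈ t.J, cs.length w < cs.length (w * cs.simple j)}

/-- `Λ` is the diagram of `w`: with the row words `r_1, …, r_k` of the subdiagram `Λ`, from top to
bottom, `w = r_k⁻¹ ⋯ r_1⁻¹`. -/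
def IsDiagramOf (t : HermitianType) (cs : CoxeterSystem t.coxeterMatrix W)
    (Λ : Finset (ℕ × ℕ)) (w : W) : Prop :=
  t.IsSubdiagram Λ ∧ w = (cs.wordProd (t.rowWord Λ))⁻¹

end HermitianType

/-- The box `b` is an outside corner of `Λ`: it lies in `Λ`, and `Λ` has no box immediately to the
right of `b` and none immediately below `b`. -/
def IsOutsideCorner (Λ : Finset (ℕ × ℕ)) (b : ℕ × ℕ) : Prop :=
  b ∈ Λ ∧ (b.1, b.2 + 1) ∉ Λ ∧ (b.1 + 1, b.2) ∉ Λ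

/-! Let `ω` be the fundamental weight of the omitted generator. For a suitable Cartan matrix it is
minuscule, and the diagram is its heap: when the boxes are added one at a time, the reflection of
each box meets a weight whose value on the corresponding simple coroot is `1`, so it subtracts
exactly one simple root. Hence `u ω` is `ω` minus the simple roots of the boxes of `Λ`
(`action_wordProd_rowWord`). In a minuscule orbit a simple reflection subtracts at most one simple
root, so `ℓ(u)` is at least the number of boxes; the row word shows equality (`length_eq`).

Passing from `u` to `su` changes only the number of boxes labelled `s`, and the change is `±1`
because the length changes by `±1`. Boxes with equal labels form a chain, so an order ideal is
determined by its label counts (`subset_of_content_le`). Thus one of `Λ`, `M` is the other plus one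
box, the sign tells whether `s` is a descent, and a box whose removal leaves an ideal is an outside
corner.

It remains to check the heap conditions type by type: for the classical types with coordinates for
the weights and the local criterion `sum_below_eq`, for `E_6` and `E_7` by evaluation. -/

/-! ### Reflections acting on coefficient vectors -/

section Reflection

variable {B : Type*}

/-- The matrix `a` is a Cartan matrix with Coxeter matrix `M`, without triple bonds. -/
def IsCartanMatrixOf (M : CoxeterMatrix B) (a : B → B → ℤ) : Prop :=
  ∀ i j, (i = j ∧ a i j = 2) ∨ (M i j = 2 ∧ a i j = 0 ∧ a j i = 0) ∨
    (M i j = 3 ∧ a i j = -1 ∧ a j i = -1) ∨ (M i j = 4 ∧ a i j = -1 ∧ a j i = -2) ∨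
    (M i j = 4 ∧ a i j = -2 ∧ a j i = -1)

theorem IsCartanMatrixOf.diag {M : CoxeterMatrix B} {a : B → B → ℤ} (h : IsCartanMatrixOf M a)
    (i : B) : a i i = 2 := by
  rcases h i i with h | h | h | h | h
  · exact h.2
  all_goals simp at h

variable [Fintype B] [DecidableEq B]

/-- The values on the simple coroots of the weight `ω - ∑ c_l α_l`, for the Cartan matrix `a`. -/
def rootPairing (a : B → B → ℤ) (ω c : B → ℤ) (k : B) : ℤ := ω k - ∑ l, c l * a l k

/-- The action of the `k`-th simple reflection on the weight `ω - ∑ c_l α_l`, expressed by the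
coefficients `c`. -/
def rootReflect (a : B → B → ℤ) (ω : B → ℤ) (k : B) (c : B → ℤ) : B → ℤ :=
  fun l ↦ c l + rootPairing a ω c k * if l = k then 1 else 0

/-- The reflection subtracts a multiple of the `k`-th simple root, whose value on the `j`-th coroot
is `a k j`: rows index roots, columns index coroots. -/
theorem rootPairing_rootReflect (a : B → B → ℤ) (ω c : B → ℤ) (k j : B) :
    rootPairing a ω (rootReflect a ω k c) j
      = rootPairing a ω c j - rootPairing a ω c k * a k j := by
  have : ∑ l, rootReflect a ω k c l * a l j
      = (∑ l, c l * a l j) + rootPairing a ω c k * a k j := by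
    simp [rootReflect, add_mul, Finset.sum_add_distrib]
  rw [rootPairing.eq_1 a ω (rootReflect a ω k c), this, rootPairing.eq_1 a ω c j]
  ring

theorem rootReflect_involutive {a : B → B → ℤ} (ω : B → ℤ) {k : B} (hk : a k k = 2) :
    Function.Involutive (rootReflect a ω k) := by
  intro c
  ext l
  simp only [rootReflect.eq_1 a ω k (rootReflect a ω k c), rootPairing_rootReflect, hk]
  rw [rootReflect]
  ring

/-- The simple reflections satisfy the braid relations. -/
theorem IsCartanMatrixOf.isLiftable {M : CoxeterMatrix B} {a : B → B → ℤ}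
    (h : IsCartanMatrixOf M a) (ω : B → ℤ) :
    M.IsLiftable fun k ↦ (rootReflect_involutive ω (h.diag k)).toPerm := by
  intro i j
  have hi := h.diag i
  have hj := h.diag j
  ext c l
  rcases h i j with ⟨rfl, -⟩ | ⟨hM, h1, h2⟩ | ⟨hM, h1, h2⟩ | ⟨hM, h1, h2⟩ | ⟨hM, h1, h2⟩
  · simp [rootReflect_involutive ω hi c]
  all_goals
    -- Only the pairings with `i` and `j` enter, and they evolve by the rank two Cartan matrix; each
    -- braid relation becomes a linear identity.
    simp only [hM, pow_succ, pow_zero, one_mul, Equiv.Perm.mul_apply,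
      Function.Involutive.coe_toPerm, Equiv.Perm.one_apply]
    simp only [rootPairing_rootReflect, hi, hj, h1, h2, rootReflect.eq_1 a ω]
    ring

/-- A Coxeter group acts on the coefficient vectors. -/
def IsCartanMatrixOf.action {M : CoxeterMatrix B} {a : B → B → ℤ} (h : IsCartanMatrixOf M a)
    (ω : B → ℤ) {W : Type*} [Group W] (cs : CoxeterSystem M W) : W →* Equiv.Perm (B → ℤ) :=
  cs.lift ⟨_, h.isLiftable ω⟩

theorem IsCartanMatrixOf.action_simple {M : CoxeterMatrix B} {a : B → B → ℤ}
    (h : IsCartanMatrixOf M a) (ω : B → ℤ) {W : Type*} [Group W] (cs : CoxeterSystem M W)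
    (k : B) (c : B → ℤ) : h.action ω cs (cs.simple k) c = rootReflect a ω k c := by
  rw [action, cs.lift_apply_simple]
  rfl

/-- The weight `ω` lies in a set of weights that is closed under the simple reflections and whose
members take values at most `1` on the simple coroots. -/
def IsMinuscule (a : B → B → ℤ) (ω : B → ℤ) : Prop :=
  ∃ Y : Set (B → ℤ), ω ∈ Y ∧ (∀ v ∈ Y, ∀ k, v k ≤ 1) ∧
    ∀ v ∈ Y, ∀ k, (fun j ↦ v j - v k * a k j) ∈ Y

/-- The sum of the coefficients of `ω - w ω` for a minuscule weight is at most the length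
of `w`. -/
theorem IsCartanMatrixOf.sum_action_le {M : CoxeterMatrix B} {a : B → B → ℤ}
    (h : IsCartanMatrixOf M a) {ω : B → ℤ} (hω : IsMinuscule a ω) {W : Type*} [Group W]
    (cs : CoxeterSystem M W) (w : W) :
    ∑ l, h.action ω cs w 0 l ≤ cs.length w := by
  obtain ⟨Y, hY, hb, hr⟩ := hω
  -- The weight stays in `Y`, where all pairings are at most `1`, so each letter adds at most `1` to
  -- the coefficient sum.
  have key : ∀ L : List B, rootPairing a ω (h.action ω cs (cs.wordProd L) 0) ∈ Y ∧
      ∑ l, h.action ω cs (cs.wordProd L) 0 l ≤ L.length := by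
    intro L
    induction L with
    | nil =>
      have : rootPairing a ω 0 = ω := by ext; simp [rootPairing]
      simpa [this] using hY
    | cons k L ih =>
      rw [cs.wordProd_cons, map_mul, Equiv.Perm.mul_apply, h.action_simple]
      constructor
      · have := hr _ ih.1 k
        convert this using 2
        exact rootPairing_rootReflect ..
      · have := hb _ ih.1 k
        simp only [rootReflect, Finset.sum_add_distrib, ← Finset.mul_sum]
        simp
        omega
  obtain ⟨L, hL, rfl⟩ := cs.exists_isReduced w
  rw [hL.eq]
  exact (key L).2

end Reflection

namespace HermitianType

variable (t : HermitianType)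

/-! ### Subdiagrams and their words -/

/-- The boxes of a set, row by row from top to bottom and from left to right in each row. -/
def rowList (Λ : Finset (ℕ × ℕ)) : List (ℕ × ℕ) :=
  (List.range (t.rank + 2)).flatMap fun i ↦
    ((List.range (t.rank + 2)).filter fun j ↦ (i, j) ∈ Λ).map fun j ↦ (i, j)

theorem rowWord_eq_map (Λ : Finset (ℕ × ℕ)) : t.rowWord Λ = (t.rowList Λ).map t.gen := by
  simp [rowWord, rowList, List.map_flatMap, Function.comp_def]

theorem mem_rowList {Λ : Finset (ℕ × ℕ)} (hΛ : Λ ⊆ t.boxes) (b : ℕ × ℕ) :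
    b ∈ t.rowList Λ ↔ b ∈ Λ := by
  obtain ⟨i, j⟩ := b
  simp only [rowList, List.mem_flatMap, List.mem_range, List.mem_map, List.mem_filter,
    decide_eq_true_eq, Prod.mk.injEq]
  constructor
  · rintro ⟨_, _, _, ⟨_, h⟩, rfl, rfl⟩
    exact h
  · intro h
    obtain ⟨h1, h2⟩ := t.lt_of_mem_boxes _ (hΛ h)
    exact ⟨i, h1, j, ⟨h2, h⟩, rfl, rfl⟩

/-- The row order is a linear extension of the componentwise order, so for a subdiagram every prefix
of the list contains all that precedes its next box and nothing beyond that box. -/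
theorem pairwise_rowList (Λ : Finset (ℕ × ℕ)) :
    (t.rowList Λ).Pairwise fun b c ↦ b.1 < c.1 ∨ b.1 = c.1 ∧ b.2 < c.2 := by
  rw [rowList, List.pairwise_flatMap]
  constructor
  · intro i _
    rw [List.pairwise_map]
    refine List.Pairwise.filter _ (List.pairwise_lt_range.imp ?_)
    intro j k h
    exact Or.inr ⟨rfl, h⟩
  · refine List.pairwise_lt_range.imp ?_
    intro i j h x hx y hy
    simp only [List.mem_map] at hx hy
    obtain ⟨_, _, rfl⟩ := hx
    obtain ⟨_, _, rfl⟩ := hy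
    exact Or.inl h

/-- The number of boxes of `Λ` for each generator. -/
def content (Λ : Finset (ℕ × ℕ)) (k : Fin t.rank) : ℤ := ∑ b ∈ Λ, if k = t.gen b then 1 else 0

theorem content_eq_card (Λ : Finset (ℕ × ℕ)) (k : Fin t.rank) :
    t.content Λ k = ((Λ.filter fun b ↦ t.gen b = k).card : ℤ) := by
  simp [content, eq_comm]

theorem sum_content (Λ : Finset (ℕ × ℕ)) : ∑ k, t.content Λ k = Λ.card := by
  simp only [content]
  rw [Finset.sum_comm]
  simp

/-- The fundamental weight of the omitted generator. -/
def weight (k : ℕ) : ℤ := if k = t.omitted then 1 else 0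

/-! ### Minuscule heaps: weights, lengths and label counts of subdiagrams -/

/-- The diagram is the heap of a minuscule weight for the Cartan matrix `a`: boxes with equal or
adjacent labels are comparable, and the weight of the boxes below a box takes the value `1` on the
coroot of that box. -/
structure IsMinusculeHeap (a : ℕ → ℕ → ℤ) : Prop where
  cartan : IsCartanMatrixOf t.coxeterMatrix fun i j ↦ a (i + 1) (j + 1)
  minuscule : IsMinuscule (fun i j : Fin t.rank ↦ a (i + 1) (j + 1)) fun k ↦ t.weight (k + 1)
  comparable : ∀ b ∈ t.boxes, ∀ c ∈ t.boxes, a (t.label c) (t.label b) ≠ 0 →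
    (c.1 ≤ b.1 ∧ c.2 ≤ b.2) ∨ (b.1 ≤ c.1 ∧ b.2 ≤ c.2)
  sum_eq : ∀ b ∈ t.boxes, ∑ c ∈ t.boxes with c.1 ≤ b.1 ∧ c.2 ≤ b.2, a (t.label c) (t.label b)
    = t.weight (t.label b) + 1

namespace IsMinusculeHeap

variable {t} {a : ℕ → ℕ → ℤ} (h : t.IsMinusculeHeap a)

include h

theorem diag {b : ℕ × ℕ} (hb : b ∈ t.boxes) : a (t.label b) (t.label b) = 2 := by
  rw [← t.gen_val_add_one b hb]
  exact h.cartan.diag _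

/-- The weight of a set of boxes that contains what lies below `b` and nothing above `b` takes the
value `1` on the coroot of `b`. -/
theorem rootPairing_content {D : Finset (ℕ × ℕ)} (hD : D ⊆ t.boxes) {b : ℕ × ℕ}
    (hb : b ∈ t.boxes) (hbelow : ∀ c ∈ t.boxes, c.1 ≤ b.1 → c.2 ≤ b.2 → c ≠ b → c ∈ D)
    (habove : ∀ c ∈ D, ¬(b.1 ≤ c.1 ∧ b.2 ≤ c.2)) :
    rootPairing (fun i j : Fin t.rank ↦ a (i + 1) (j + 1)) (fun k ↦ t.weight (k + 1))
      (t.content D) (t.gen b) = 1 := by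
  have hbD : b ∉ D := fun hb ↦ habove b hb ⟨le_rfl, le_rfl⟩
  have h1 : ∑ l, t.content D l * a (l + 1) (t.gen b + 1)
      = ∑ c ∈ D, a (t.label c) (t.label b) := by
    simp only [content, Finset.sum_mul]
    rw [Finset.sum_comm]
    refine Finset.sum_congr rfl fun c hc ↦ ?_
    rw [← t.gen_val_add_one b hb, ← t.gen_val_add_one c (hD hc)]
    simp
  -- A box of `D` not preceding `b` contributes zero: a nonzero entry would make it comparable to
  -- `b`, hence beyond `b`.
  have h2 : ∑ c ∈ t.boxes with c.1 ≤ b.1 ∧ c.2 ≤ b.2, a (t.label c) (t.label b)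
      = ∑ c ∈ insert b D, a (t.label c) (t.label b) := by
    refine Finset.sum_subset ?_ ?_
    · intro c hc
      simp only [Finset.mem_filter] at hc
      by_cases hcb : c = b
      · simp [hcb]
      · exact Finset.mem_insert_of_mem (hbelow c hc.1 hc.2.1 hc.2.2 hcb)
    · intro c hc hc'
      by_contra hne
      rcases Finset.mem_insert.1 hc with rfl | hc
      · simp [hb] at hc'
      · rcases h.comparable b hb c (hD hc) hne with hle | hle
        · exact hc' (Finset.mem_filter.2 ⟨hD hc, hle⟩)
        · exact habove c hc hle
  -- The sum in `sum_eq` includes `b` itself, which contributes `2`; removing it leaves the weight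
  -- minus `1`.
  rw [h.sum_eq b hb, Finset.sum_insert hbD, h.diag hb] at h2
  rw [rootPairing, h1, t.gen_val_add_one b hb]
  omega

/-- The element with diagram `Λ` moves the fundamental weight `ω` to `ω` minus the sum of the
simple roots of the boxes of `Λ`. -/
theorem action_wordProd_rowWord {W : Type*} [Group W] (cs : CoxeterSystem t.coxeterMatrix W)
    {Λ : Finset (ℕ × ℕ)} (hΛ : t.IsSubdiagram Λ) :
    h.cartan.action (fun k ↦ t.weight (k + 1)) cs (cs.wordProd (t.rowWord Λ))⁻¹ 0
      = t.content Λ := by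
  have key : ∀ L R : List (ℕ × ℕ), L ++ R = t.rowList Λ →
      h.cartan.action (fun k ↦ t.weight (k + 1)) cs (cs.wordProd (L.map t.gen))⁻¹ 0
        = t.content L.toFinset := by
    intro L
    -- Inversion reverses the word, so the last box of the list acts last; the list therefore grows
    -- at its end.
    induction L using List.reverseRecOn with
    | nil => intro R _; ext; simp [content]
    | append_singleton L b ih =>
      intro R hLR
      have hmem := t.mem_rowList hΛ.1
      have hp := t.pairwise_rowList Λ
      rw [← hLR] at hmem hp
      simp only [List.append_assoc, List.cons_append, List.nil_append, List.mem_append,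
        List.mem_cons] at hmem hp
      rw [List.pairwise_append] at hp
      obtain ⟨-, hp2, hp3⟩ := hp
      rw [List.pairwise_cons] at hp2
      have hb : b ∈ Λ := (hmem b).1 (by simp)
      have hL : L.toFinset ⊆ t.boxes := by
        intro c hc
        exact hΛ.1 ((hmem c).1 (Or.inl (List.mem_toFinset.1 hc)))
      have habove : ∀ c ∈ L.toFinset, ¬(b.1 ≤ c.1 ∧ b.2 ≤ c.2) := by
        intro c hc
        have := hp3 c (List.mem_toFinset.1 hc) b (by simp)
        omega
      have hpair := h.rootPairing_content hL (hΛ.1 hb) (by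
        intro c hc h1 h2 h3
        rcases (hmem c).2 (hΛ.2 b hb c hc h1 h2) with h4 | h4 | h4
        · exact List.mem_toFinset.2 h4
        · exact absurd h4 h3
        · have := hp2.1 c h4
          omega) habove
      rw [List.map_append, cs.wordProd_append, mul_inv_rev, List.map_singleton,
        cs.wordProd_singleton, cs.inv_simple, map_mul, Equiv.Perm.mul_apply,
        ih (b :: R) (by simpa using hLR), h.cartan.action_simple]
      ext l
      rw [rootReflect, hpair, List.toFinset_append, Finset.union_comm]
      simp only [List.toFinset_cons, List.toFinset_nil, insert_empty_eq]
      rw [← Finset.insert_eq, content, content, Finset.sum_insert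
        (fun hb ↦ habove b hb ⟨le_rfl, le_rfl⟩)]
      ring
  have hL : (t.rowList Λ).toFinset = Λ := by
    ext b
    rw [List.mem_toFinset, t.mem_rowList hΛ.1]
  rw [t.rowWord_eq_map, key _ [] (List.append_nil _), hL]

/-- The row word bounds the length from above, the coefficient sum of `ω - u ω` from below. -/
theorem length_eq {W : Type*} [Group W] (cs : CoxeterSystem t.coxeterMatrix W)
    {Λ : Finset (ℕ × ℕ)} {u : W} (hu : t.IsDiagramOf cs Λ u) : cs.length u = Λ.card := by
  obtain ⟨hΛ, rfl⟩ := hu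
  apply le_antisymm
  · rw [cs.length_inv]
    refine (cs.length_wordProd_le _).trans ?_
    have hnd : (t.rowList Λ).Nodup := by
      refine (t.pairwise_rowList Λ).imp ?_
      rintro b _ hb rfl
      omega
    rw [t.rowWord_eq_map, List.length_map, ← List.toFinset_card_of_nodup hnd]
    apply Finset.card_le_card
    intro b hb
    exact (t.mem_rowList hΛ.1 b).1 (List.mem_toFinset.1 hb)
  · have := h.cartan.sum_action_le h.minuscule cs (cs.wordProd (t.rowWord Λ))⁻¹
    rw [h.action_wordProd_rowWord cs hΛ, t.sum_content] at this
    exact_mod_cast this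

/-- Subdiagrams are determined by their contents. -/
theorem subset_of_content_le {Λ M : Finset (ℕ × ℕ)} (hΛ : t.IsSubdiagram Λ)
    (hM : t.IsSubdiagram M) (hle : ∀ k, t.content Λ k ≤ t.content M k) : Λ ⊆ M := by
  intro b hb
  by_contra hbM
  have hk := hle (t.gen b)
  rw [content_eq_card, content_eq_card, Nat.cast_le] at hk
  -- A box of `M` with the label of `b` is comparable to `b`. It cannot lie beyond `b`, as `M` would
  -- then contain `b`; so it precedes `b` and lies in `Λ`. Thus `Λ` has strictly more boxes with
  -- this label.
  refine absurd hk (not_le.2 (Finset.card_lt_card ⟨?_, ?_⟩))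
  · intro c hc
    obtain ⟨hcM, hcb⟩ := Finset.mem_filter.1 hc
    refine Finset.mem_filter.2 ⟨?_, hcb⟩
    have hlab : t.label c = t.label b := by
      rw [← t.gen_val_add_one b (hΛ.1 hb), ← t.gen_val_add_one c (hM.1 hcM), hcb]
    have hne : a (t.label c) (t.label b) ≠ 0 := by
      rw [hlab, h.diag (hΛ.1 hb)]
      decide
    rcases h.comparable b (hΛ.1 hb) c (hM.1 hcM) hne with hcomp | hcomp
    · exact hΛ.2 b hb c (hM.1 hcM) hcomp.1 hcomp.2
    · exact absurd (hM.2 c hcM b (hΛ.1 hb) hcomp.1 hcomp.2) hbM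
  · intro hsub
    exact hbM (Finset.mem_filter.1 (hsub (Finset.mem_filter.2 ⟨hb, rfl⟩))).1

/-- Either `Λ` is `M` with one box added, or `M` is `Λ` with one box added. -/
theorem subset_or_subset {W : Type*} [Group W] (cs : CoxeterSystem t.coxeterMatrix W)
    {Λ M : Finset (ℕ × ℕ)} {u : W} {s : Fin t.rank} (hΛ : t.IsDiagramOf cs Λ u)
    (hM : t.IsDiagramOf cs M (cs.simple s * u)) :
    (Λ ⊆ M ∧ M.card = Λ.card + 1) ∨ (M ⊆ Λ ∧ Λ.card = M.card + 1) := by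
  have hlen := cs.length_simple_mul u s
  rw [h.length_eq cs hΛ, h.length_eq cs hM] at hlen
  have hcM := h.action_wordProd_rowWord cs hM.1
  rw [← hM.2, map_mul, Equiv.Perm.mul_apply, h.cartan.action_simple, hΛ.2,
    h.action_wordProd_rowWord cs hΛ.1] at hcM
  have hcM' : ∀ k, t.content M k = _ := fun k ↦ (congrFun hcM k).symm
  simp only [rootReflect] at hcM'
  -- Summing over all labels identifies the pairing at `s` with the change of length, so it is `±1`
  -- and the contents are comparable.
  have hsum : (M.card : ℤ) = Λ.card + rootPairing (fun i j : Fin t.rank ↦ a (i + 1) (j + 1))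
      (fun k ↦ t.weight (k + 1)) (t.content Λ) s := by
    rw [← t.sum_content M, ← t.sum_content Λ]
    simp [hcM', Finset.sum_add_distrib]
  rcases hlen with hlen | hlen
  · refine Or.inl ⟨h.subset_of_content_le hΛ.1 hM.1 fun k ↦ ?_, hlen⟩
    rw [hcM' k]
    split_ifs <;> omega
  · refine Or.inr ⟨h.subset_of_content_le hM.1 hΛ.1 fun k ↦ ?_, hlen.symm⟩
    rw [hcM' k]
    split_ifs <;> omega

end IsMinusculeHeap

/-! ### Descents and outside corners -/

/-- A box whose removal leaves a subdiagram is an outside corner. -/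
theorem exists_outsideCorner {Λ M : Finset (ℕ × ℕ)} (hΛ : t.IsSubdiagram Λ)
    (hM : t.IsSubdiagram M) (hsub : M ⊆ Λ) (hcard : Λ.card = M.card + 1) :
    ∃ b, Λ \ M = {b} ∧ IsOutsideCorner Λ b := by
  have h1 : (Λ \ M).card = 1 := by
    rw [Finset.card_sdiff_of_subset hsub]
    omega
  obtain ⟨b, hb⟩ := Finset.card_eq_one.1 h1
  have hmem : ∀ c, c ∈ Λ → c ≠ b → c ∈ M := by
    intro c hc hcb
    by_contra hcM
    have : c ∈ Λ \ M := Finset.mem_sdiff.2 ⟨hc, hcM⟩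
    rw [hb] at this
    exact hcb (Finset.mem_singleton.1 this)
  have hbΛ : b ∈ Λ \ M := by simp [hb]
  rw [Finset.mem_sdiff] at hbΛ
  -- A right or lower neighbour of `b` in `Λ` would lie in `M`, which would then contain `b`.
  refine ⟨b, hb, hbΛ.1, fun hc ↦ hbΛ.2 ?_, fun hc ↦ hbΛ.2 ?_⟩
  · exact hM.2 _ (hmem _ hc (by simp [Prod.ext_iff])) b (hΛ.1 hbΛ.1) le_rfl (Nat.le_succ _)
  · exact hM.2 _ (hmem _ hc (by simp [Prod.ext_iff])) b (hΛ.1 hbΛ.1) (Nat.le_succ _) le_rfl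

theorem IsMinusculeHeap.isLeftDescent_iff {t : HermitianType} {a : ℕ → ℕ → ℤ}
    (h : t.IsMinusculeHeap a) {W : Type*} [Group W] (cs : CoxeterSystem t.coxeterMatrix W)
    {Λ M : Finset (ℕ × ℕ)} {u : W} {s : Fin t.rank} (hΛ : t.IsDiagramOf cs Λ u)
    (hM : t.IsDiagramOf cs M (cs.simple s * u)) :
    (cs.IsLeftDescent u s ↔ ∃ b, Λ \ M = {b} ∧ IsOutsideCorner Λ b) ∧
      (¬ cs.IsLeftDescent u s → ∃ b, M \ Λ = {b} ∧ IsOutsideCorner M b) := by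
  rw [CoxeterSystem.IsLeftDescent, h.length_eq cs hΛ, h.length_eq cs hM]
  rcases h.subset_or_subset cs hΛ hM with ⟨hsub, hcard⟩ | ⟨hsub, hcard⟩
  · refine ⟨⟨fun _ ↦ by omega, ?_⟩, fun _ ↦ t.exists_outsideCorner hM.1 hΛ.1 hsub hcard⟩
    rintro ⟨b, hb, -⟩
    rw [Finset.sdiff_eq_empty_iff_subset.2 hsub] at hb
    exact absurd hb.symm (Finset.singleton_ne_empty b)
  · exact ⟨⟨fun _ ↦ t.exists_outsideCorner hΛ.1 hM.1 hsub hcard, fun _ ↦ by omega⟩,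
      fun hn ↦ absurd (show M.card < Λ.card by omega) hn⟩

/-! ### Reduction of the heap sums to neighbouring boxes -/

/-- A local criterion for `IsMinusculeHeap.sum_eq`: between a box `b` and the preceding box `b'`
with the same label, or below the first box `b` with its label, the boxes with adjacent labels are
those of an explicit set `T`. -/
theorem sum_below_eq (t : HermitianType) {a : ℕ → ℕ → ℤ} (hdiag : ∀ k, a k k = 2)
    (hloc : ∀ b ∈ t.boxes, ∃ T : Finset (ℕ × ℕ),
      (∀ c ∈ T, c ∈ t.boxes ∧ c.1 ≤ b.1 ∧ c.2 ≤ b.2 ∧ c ≠ b) ∧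
      (((∀ c ∈ t.boxes, c.1 ≤ b.1 → c.2 ≤ b.2 → c ≠ b → a (t.label c) (t.label b) ≠ 0 → c ∈ T) ∧
        ∑ c ∈ T, a (t.label c) (t.label b) = t.weight (t.label b) - 1) ∨
      ∃ b' ∈ t.boxes, b'.1 < b.1 ∧ b'.2 ≤ b.2 ∧ t.label b' = t.label b ∧
        (∀ c ∈ T, ¬(c.1 ≤ b'.1 ∧ c.2 ≤ b'.2)) ∧
        (∀ c ∈ t.boxes, c.1 ≤ b.1 → c.2 ≤ b.2 → c ≠ b → a (t.label c) (t.label b) ≠ 0 →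
          (c.1 ≤ b'.1 ∧ c.2 ≤ b'.2) ∨ c ∈ T) ∧
        ∑ c ∈ T, a (t.label c) (t.label b) = -2)) :
    ∀ b ∈ t.boxes, ∑ c ∈ t.boxes with c.1 ≤ b.1 ∧ c.2 ≤ b.2, a (t.label c) (t.label b)
      = t.weight (t.label b) + 1 := by
  suffices h : ∀ i, ∀ b ∈ t.boxes, b.1 = i →
      ∑ c ∈ t.boxes with c.1 ≤ b.1 ∧ c.2 ≤ b.2, a (t.label c) (t.label b)
        = t.weight (t.label b) + 1 from fun b hb ↦ h _ b hb rfl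
  intro i
  induction i using Nat.strong_induction_on with
  | _ i ih =>
    rintro b hb rfl
    obtain ⟨T, hT, ⟨hT', hsum⟩ | ⟨b', hb', hlt, hle, hlab, hdisj, hT', hsum⟩⟩ := hloc b hb
    · have h1 : ∑ c ∈ insert b T, a (t.label c) (t.label b)
          = ∑ c ∈ t.boxes with c.1 ≤ b.1 ∧ c.2 ≤ b.2, a (t.label c) (t.label b) := by
        refine Finset.sum_subset ?_ ?_
        · intro c hc
          rcases Finset.mem_insert.1 hc with rfl | hc
          · simp [hb]
          · obtain ⟨h1, h2, h3, -⟩ := hT c hc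
            exact Finset.mem_filter.2 ⟨h1, h2, h3⟩
        · intro c hc hc'
          obtain ⟨h1, h2, h3⟩ := Finset.mem_filter.1 hc
          by_contra hne
          refine hc' ?_
          by_cases hcb : c = b
          · simp [hcb]
          · exact Finset.mem_insert_of_mem (hT' c h1 h2 h3 hcb hne)
      rw [← h1, Finset.sum_insert (fun h ↦ (hT b h).2.2.2 rfl), hsum, hdiag]
      ring
    -- Up to zero terms, the boxes up to `b` are `b`, contributing `2`, then `T`, contributing `-2`,
    -- and the boxes up to `b'`, handled by induction since `b'` is in an earlier row.
    · have h1 : ∑ c ∈ insert b T ∪ t.boxes.filter (fun c ↦ c.1 ≤ b'.1 ∧ c.2 ≤ b'.2),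
            a (t.label c) (t.label b)
          = ∑ c ∈ t.boxes with c.1 ≤ b.1 ∧ c.2 ≤ b.2, a (t.label c) (t.label b) := by
        refine Finset.sum_subset ?_ ?_
        · intro c hc
          rcases Finset.mem_union.1 hc with hc | hc
          · rcases Finset.mem_insert.1 hc with rfl | hc
            · simp [hb]
            · obtain ⟨h1, h2, h3, -⟩ := hT c hc
              exact Finset.mem_filter.2 ⟨h1, h2, h3⟩
          · obtain ⟨h1, h2, h3⟩ := Finset.mem_filter.1 hc
            exact Finset.mem_filter.2 ⟨h1, by omega, by omega⟩
        · intro c hc hc'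
          obtain ⟨h1, h2, h3⟩ := Finset.mem_filter.1 hc
          by_contra hne
          refine hc' ?_
          by_cases hcb : c = b
          · simp [hcb]
          · rcases hT' c h1 h2 h3 hcb hne with h4 | h4
            · exact Finset.mem_union_right _ (Finset.mem_filter.2 ⟨h1, h4⟩)
            · exact Finset.mem_union_left _ (Finset.mem_insert_of_mem h4)
      have h2 : Disjoint (insert b T) (t.boxes.filter fun c ↦ c.1 ≤ b'.1 ∧ c.2 ≤ b'.2) := by
        rw [Finset.disjoint_left]
        intro c hc hc'
        have hc' := (Finset.mem_filter.1 hc').2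
        rcases Finset.mem_insert.1 hc with rfl | hc
        · omega
        · exact hdisj c hc hc'
      have h3 := ih _ hlt b' hb' rfl
      rw [hlab] at h3
      rw [← h1, Finset.sum_union h2, h3, Finset.sum_insert (fun h ↦ (hT b h).2.2.2 rfl), hsum,
        hdiag]
      ring

/-! ### Type `A` -/

/-- The Cartan matrix of a path. -/
def cartanA (k l : ℕ) : ℤ := if k = l then 2 else if k + 1 = l ∨ l + 1 = k then -1 else 0

theorem isMinusculeHeap_A (n p : ℕ) (hp : 1 ≤ p) (hpn : p ≤ n) :
    (A n p hp hpn).IsMinusculeHeap cartanA where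
  cartan := by
    intro i j
    have hM : (A n p hp hpn).coxeterMatrix i j = if i = j then 1
      else (if (j : ℕ) + 1 = i ∨ (i : ℕ) + 1 = j then 3 else 2) := rfl
    simp only [hM, cartanA, Fin.ext_iff]
    split_ifs <;> omega
  minuscule := by
    -- These are the weights of the exterior powers: `x` is a 0-1 vector, reflections swap adjacent
    -- coordinates, and `ω` has its first `p` coordinates equal to `1`.
    refine ⟨{v | ∃ x : ℕ → ℤ, (∀ i, x i = 0 ∨ x i = 1) ∧ ∀ k, v k = x k - x (k + 1)},
      ⟨fun i ↦ if i < p then 1 else 0, fun i ↦ ?_, fun k ↦ ?_⟩, ?_, ?_⟩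
    · dsimp only
      split_ifs <;> simp
    · simp only [weight, omitted]
      split_ifs <;> omega
    · rintro v ⟨x, hx, hv⟩ k
      have h1 := hx k
      have h2 := hx (k + 1)
      have h3 := hv k
      omega
    · rintro v ⟨x, hx, hv⟩ k
      refine ⟨fun i ↦ if i = k then x (k + 1) else if i = k + 1 then x k else x i, fun i ↦ ?_,
        fun j ↦ ?_⟩
      · grind
      · simp only [hv, cartanA]
        grind
  comparable := by
    rintro ⟨i, j⟩ hb ⟨i', j'⟩ hc
    simp only [boxes, Finset.mem_product, Finset.mem_range] at hb hc
    simp only [cartanA, label]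
    split_ifs <;> omega
  sum_eq := by
    refine sum_below_eq _ (by simp [cartanA]) ?_
    -- Boxes in the first row or column are the first with their label. Any other box has its
    -- predecessor diagonally up and to the left, with two boxes of adjacent labels in between.
    rintro ⟨_ | i, _ | j⟩ hb
    · refine ⟨∅, by simp, Or.inl ⟨?_, ?_⟩⟩
      · rintro ⟨i', j'⟩ hc
        simp
        omega
      · simp [weight, label, omitted]
    · refine ⟨{(0, j)}, ?_, Or.inl ⟨?_, ?_⟩⟩
      all_goals
        simp only [Finset.mem_singleton, forall_eq, boxes, Finset.mem_product, Finset.mem_range,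
          Prod.forall, cartanA, label, weight, omitted, Finset.sum_singleton, Prod.mk.injEq,
          ne_eq] at *
        grind
    · refine ⟨{(i, 0)}, ?_, Or.inl ⟨?_, ?_⟩⟩
      all_goals
        simp only [Finset.mem_singleton, forall_eq, boxes, Finset.mem_product, Finset.mem_range,
          Prod.forall, cartanA, label, weight, omitted, Finset.sum_singleton, Prod.mk.injEq,
          ne_eq] at *
        grind
    · refine ⟨{(i, j + 1), (i + 1, j)}, ?_, Or.inr ⟨(i, j), ?_, ?_, ?_, ?_, ?_, ?_, ?_⟩⟩
      all_goals
        try rw [Finset.sum_pair (by simp)]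
        simp only [Finset.mem_insert, Finset.mem_singleton, forall_eq_or_imp, forall_eq, boxes,
          Finset.mem_product, Finset.mem_range, Prod.forall, cartanA, label, Prod.mk.injEq,
          ne_eq] at *
        grind

/-! ### Types `B` and `C` -/

/-- The Cartan matrix of type `C_n`, with simple coroots indexing the columns. -/
def cartanC (n k l : ℕ) : ℤ :=
  if k = l then 2 else if k + 1 = n ∧ l = n then -2 else if k + 1 = l ∨ l + 1 = k then -1 else 0

theorem isMinusculeHeap_C (n : ℕ) (hn : 2 ≤ n) : (C n hn).IsMinusculeHeap (cartanC n) where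
  cartan := by
    intro i j
    have hM : (C n hn).coxeterMatrix i j = if i = j then 1
      else (if (i : ℕ) = n - 1 ∧ (j : ℕ) = n - 2 ∨ (j : ℕ) = n - 1 ∧ (i : ℕ) = n - 2 then 4
        else (if (j : ℕ) + 1 = i ∨ (i : ℕ) + 1 = j then 3 else 2)) := rfl
    have hi : i.val < n := i.2
    have hj : j.val < n := j.2
    simp only [hM, cartanC, Fin.ext_iff]
    clear hM
    grind (splits := 30)
  minuscule := by
    -- Spin weights: the coordinates are `x i - 1/2`, the last coroot is twice the last coordinate,
    -- and the last reflection changes its sign, that is `x` to `1 - x`.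
    refine ⟨{v | ∃ x : ℕ → ℤ, (∀ i, x i = 0 ∨ x i = 1) ∧
        ∀ k, v k = if k.val + 1 = n then 2 * x k - 1 else x k - x (k + 1)},
      ⟨fun i ↦ 1, fun i ↦ Or.inr rfl, fun k ↦ ?_⟩, ?_, ?_⟩
    · simp only [weight, omitted]
      split_ifs <;> omega
    · rintro v ⟨x, hx, hv⟩ k
      have h1 := hx k
      have h2 := hx (k + 1)
      have h3 := hv k
      split_ifs at h3 <;> omega
    · rintro v ⟨x, hx, hv⟩ k
      have hk : k.val < n := k.2
      refine ⟨fun i ↦ if k.val + 1 = n then (if i = k then 1 - x k else x i)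
        else if i = k then x (k + 1) else if i = k + 1 then x k else x i, fun i ↦ ?_, fun j ↦ ?_⟩
      · grind
      · have hj : j.val < n := j.2
        simp only [hv, cartanC]
        grind
  comparable := by
    rintro ⟨i, j⟩ hb ⟨i', j'⟩ hc
    simp only [boxes, Finset.mem_filter, Finset.mem_product, Finset.mem_range] at hb hc
    simp only [cartanC, label]
    split_ifs <;> omega
  sum_eq := by
    refine sum_below_eq _ (by simp [cartanC]) ?_
    rintro ⟨_ | i, _ | j⟩ hb
    · refine ⟨∅, by simp, Or.inl ⟨?_, ?_⟩⟩
      · rintro ⟨i', j'⟩ hc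
        simp
        omega
      · simp [weight, label, omitted]
    · refine ⟨{(0, j)}, ?_, Or.inl ⟨?_, ?_⟩⟩
      all_goals
        simp only [Finset.mem_singleton, forall_eq, boxes, Finset.mem_product, Finset.mem_range,
          Finset.mem_filter, Prod.forall, cartanC, label, weight, omitted, Finset.sum_singleton,
          Prod.mk.injEq, ne_eq] at *
        grind
    · simp [boxes] at hb
    · rcases eq_or_ne i j with rfl | hij
      -- Between consecutive diagonal boxes the only adjacent label is one `n - 1`; the entry `-2`
      -- of `cartanC` makes it suffice.
      · refine ⟨{(i, i + 1)}, ?_, Or.inr ⟨(i, i), ?_, ?_, ?_, ?_, ?_, ?_, ?_⟩⟩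
        all_goals
          simp only [Finset.mem_singleton, forall_eq, boxes, Finset.mem_product, Finset.mem_range,
            Finset.mem_filter, Prod.forall, cartanC, label, Finset.sum_singleton,
            Prod.mk.injEq, ne_eq] at *
          grind
      · refine ⟨{(i, j + 1), (i + 1, j)}, ?_, Or.inr ⟨(i, j), ?_, ?_, ?_, ?_, ?_, ?_, ?_⟩⟩
        all_goals
          try rw [Finset.sum_pair (by simp)]
          simp only [Finset.mem_insert, Finset.mem_singleton, forall_eq_or_imp, forall_eq, boxes,
            Finset.mem_product, Finset.mem_range, Finset.mem_filter, Prod.forall, cartanC, label,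
            Prod.mk.injEq, ne_eq] at *
          grind

/-- The Cartan matrix of type `B_n`, with simple coroots indexing the columns. -/
def cartanB (n k l : ℕ) : ℤ :=
  if k = l then 2 else if k = n ∧ l + 1 = n then -2 else if k + 1 = l ∨ l + 1 = k then -1 else 0

theorem isMinusculeHeap_B (n : ℕ) (hn : 2 ≤ n) : (B n hn).IsMinusculeHeap (cartanB n) where
  cartan := by
    intro i j
    have hM : (B n hn).coxeterMatrix i j = if i = j then 1
      else (if (i : ℕ) = n - 1 ∧ (j : ℕ) = n - 2 ∨ (j : ℕ) = n - 1 ∧ (i : ℕ) = n - 2 then 4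
        else (if (j : ℕ) + 1 = i ∨ (i : ℕ) + 1 = j then 3 else 2)) := rfl
    have hi : i.val < n := i.2
    have hj : j.val < n := j.2
    simp only [hM, cartanB, Fin.ext_iff]
    clear hM
    grind (splits := 30)
  minuscule := by
    -- At most one coordinate is nonzero, so `x` is zero or plus or minus a unit vector; the last
    -- reflection negates the last coordinate.
    refine ⟨{v | ∃ x : ℕ → ℤ, (∀ i, -1 ≤ x i ∧ x i ≤ 1) ∧ (∀ i j, i ≠ j → x i = 0 ∨ x j = 0) ∧
        ∀ k, v k = if k.val + 1 = n then x k else x k - x (k + 1)},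
      ⟨fun i ↦ if i = 0 then 1 else 0, fun i ↦ ?_, fun i j ↦ ?_, fun k ↦ ?_⟩, ?_, ?_⟩
    · grind
    · grind
    · simp only [weight, omitted]
      grind
    · rintro v ⟨x, hx, hx', hv⟩ k
      have h1 := hx k
      have h2 := hx (k + 1)
      have h3 := hv k
      have h4 := hx' k (k + 1) (by omega)
      split_ifs at h3 <;> omega
    · rintro v ⟨x, hx, hx', hv⟩ k
      have hk : k.val < n := k.2
      refine ⟨fun i ↦ if k.val + 1 = n then (if i = k then -x k else x i)
        else if i = k then x (k + 1) else if i = k + 1 then x k else x i, fun i ↦ ?_,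
        fun i j hij ↦ ?_, fun j ↦ ?_⟩
      · grind
      · grind
      · have hj : j.val < n := j.2
        simp only [hv, cartanB]
        grind
  comparable := by
    rintro ⟨i, j⟩ hb ⟨i', j'⟩ hc
    simp only [boxes, Finset.mem_filter, Finset.mem_product, Finset.mem_range] at hb hc
    simp only [cartanB, label]
    split_ifs <;> omega
  sum_eq := by
    refine sum_below_eq _ (by simp [cartanB]) ?_
    rintro ⟨_ | _ | i, j⟩ hb
    · rcases j with _ | j
      · refine ⟨∅, by simp, Or.inl ⟨?_, ?_⟩⟩
        · rintro ⟨i', j'⟩ hc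
          simp
          omega
        · simp [weight, label, omitted]
      · refine ⟨{(0, j)}, ?_, Or.inl ⟨?_, ?_⟩⟩
        all_goals
          simp only [Finset.mem_singleton, forall_eq, boxes, Finset.mem_product, Finset.mem_range,
            Finset.mem_filter, Prod.forall, cartanB, label, weight, omitted,
            Finset.sum_singleton, Prod.mk.injEq, ne_eq] at *
          grind
    · refine ⟨{(0, n - 1)}, ?_, Or.inr ⟨(0, n - 2), ?_, ?_, ?_, ?_, ?_, ?_, ?_⟩⟩
      all_goals
        simp only [Finset.mem_singleton, forall_eq, boxes, Finset.mem_product, Finset.mem_range,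
          Finset.mem_filter, Prod.forall, cartanB, label, Finset.sum_singleton,
          Prod.mk.injEq, ne_eq] at *
        grind
    -- The label `n - 2 - i` last occurred in row `0`; since then `n - 1 - i` has occurred twice,
    -- once on the way to `n` and once on the way back.
    · refine ⟨{(0, n - 2 - i), (i + 1, n - 1)}, ?_,
        Or.inr ⟨(0, n - 3 - i), ?_, ?_, ?_, ?_, ?_, ?_, ?_⟩⟩
      all_goals
        try rw [Finset.sum_pair (by simp)]
        simp only [Finset.mem_insert, Finset.mem_singleton, forall_eq_or_imp, forall_eq, boxes,
          Finset.mem_product, Finset.mem_range, Finset.mem_filter, Prod.forall, cartanB, label,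
          Prod.mk.injEq, ne_eq] at *
        grind

/-! ### Type `D` -/

/-- The Cartan matrix of type `D_n`. -/
def cartanD (n k l : ℕ) : ℤ :=
  if k = l then 2
  else if (k + 1 = l ∧ l < n) ∨ (l + 1 = k ∧ k < n) ∨ (k + 2 = l ∧ l = n) ∨ (l + 2 = k ∧ k = n)
  then -1 else 0

theorem isCartanMatrixOf_cartanD (n : ℕ) :
    IsCartanMatrixOf (coxeterMatrixD n) fun i j ↦ cartanD n (i + 1) (j + 1) := by
  intro i j
  simp only [coxeterMatrixD, Matrix.of_apply, cartanD, Fin.ext_iff]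
  grind

theorem isMinusculeHeap_DA (n : ℕ) (hn : 3 ≤ n) : (DA n hn).IsMinusculeHeap (cartanD n) where
  cartan := isCartanMatrixOf_cartanD n
  minuscule := by
    -- Weights of both half-spin representations, with coordinates `x i - 1/2`; the last coroot is
    -- the sum of the last two coordinates, and its reflection swaps and negates them.
    refine ⟨{v | ∃ x : ℕ → ℤ, (∀ i, x i = 0 ∨ x i = 1) ∧
        ∀ k, v k = if k.val + 1 = n then x (n - 2) + x (n - 1) - 1 else x k - x (k + 1)},
      ⟨fun i ↦ 1, fun i ↦ Or.inr rfl, fun k ↦ ?_⟩, ?_, ?_⟩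
    · simp only [weight, omitted]
      split_ifs <;> omega
    · rintro v ⟨x, hx, hv⟩ k
      grind
    · rintro v ⟨x, hx, hv⟩ k
      have hk : k.val < n := k.2
      refine ⟨fun i ↦ if k.val + 1 = n then
          (if i = n - 2 then 1 - x (n - 1) else if i = n - 1 then 1 - x (n - 2) else x i)
        else if i = k then x (k + 1) else if i = k + 1 then x k else x i, fun i ↦ ?_, fun j ↦ ?_⟩
      · grind
      · have hj : j.val < n := j.2
        simp only [hv, cartanD]
        grind
  comparable := by
    rintro ⟨i, j⟩ hb ⟨i', j'⟩ hc
    simp only [boxes, Finset.mem_filter, Finset.mem_product, Finset.mem_range] at hb hc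
    simp only [cartanD, label]
    split_ifs <;> omega
  sum_eq := by
    refine sum_below_eq _ (by simp [cartanD]) ?_
    rintro ⟨i, j⟩ hb
    rcases eq_or_ne i j with rfl | hij
    · rcases i with _ | _ | i
      · refine ⟨∅, by simp, Or.inl ⟨?_, ?_⟩⟩
        · rintro ⟨i', j'⟩ hc
          simp
          omega
        · simp [weight, label, omitted]
      · refine ⟨{(0, 1)}, ?_, Or.inl ⟨?_, ?_⟩⟩
        all_goals
          simp only [Finset.mem_singleton, forall_eq, boxes, Finset.mem_product, Finset.mem_range,
            Finset.mem_filter, Prod.forall, cartanD, label, weight, omitted,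
            Finset.sum_singleton, Prod.mk.injEq, ne_eq] at *
          grind
      -- The labels `n` and `n - 1`, which are not adjacent, alternate on the diagonal, so the same
      -- label is two steps back; the boxes of `T` both carry `n - 2`.
      · refine ⟨{(i, i + 1), (i + 1, i + 2)}, ?_, Or.inr ⟨(i, i), ?_, ?_, ?_, ?_, ?_, ?_, ?_⟩⟩
        all_goals
          try rw [Finset.sum_pair (by simp)]
          simp only [Finset.mem_insert, Finset.mem_singleton, forall_eq_or_imp, forall_eq, boxes,
            Finset.mem_product, Finset.mem_range, Finset.mem_filter, Prod.forall, cartanD, label,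
            Prod.mk.injEq, ne_eq] at *
          grind
    · rcases j with _ | j
      · simp [boxes] at hb
        omega
      rcases i with _ | i
      · refine ⟨{(0, j)}, ?_, Or.inl ⟨?_, ?_⟩⟩
        all_goals
          simp only [Finset.mem_singleton, forall_eq, boxes, Finset.mem_product, Finset.mem_range,
            Finset.mem_filter, Prod.forall, cartanD, label, weight, omitted,
            Finset.sum_singleton, Prod.mk.injEq, ne_eq] at *
          grind
      · refine ⟨{(i, j + 1), (i + 1, j)}, ?_, Or.inr ⟨(i, j), ?_, ?_, ?_, ?_, ?_, ?_, ?_⟩⟩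
        all_goals
          try rw [Finset.sum_pair (by simp)]
          simp only [Finset.mem_insert, Finset.mem_singleton, forall_eq_or_imp, forall_eq, boxes,
            Finset.mem_product, Finset.mem_range, Finset.mem_filter, Prod.forall, cartanD, label,
            Prod.mk.injEq, ne_eq] at *
          grind

theorem isMinusculeHeap_DD (n : ℕ) (hn : 3 ≤ n) : (DD n hn).IsMinusculeHeap (cartanD n) where
  cartan := isCartanMatrixOf_cartanD n
  minuscule := by
    refine ⟨{v | ∃ x : ℕ → ℤ, (∀ i, -1 ≤ x i ∧ x i ≤ 1) ∧ (∀ i j, i ≠ j → x i = 0 ∨ x j = 0) ∧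
        ∀ k, v k = if k.val + 1 = n then x (n - 2) + x (n - 1) else x k - x (k + 1)},
      ⟨fun i ↦ if i = 0 then 1 else 0, fun i ↦ ?_, fun i j ↦ ?_, fun k ↦ ?_⟩, ?_, ?_⟩
    · grind
    · grind
    · simp only [weight, omitted]
      grind
    · rintro v ⟨x, hx, hx', hv⟩ k
      have h1 := hx k
      have h2 := hx (k + 1)
      have h3 := hv k
      have h4 := hx' k (k + 1) (by omega)
      have h5 := hx' (n - 2) (n - 1) (by omega)
      have h6 := hx (n - 2)
      have h7 := hx (n - 1)
      split_ifs at h3 <;> omega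
    · rintro v ⟨x, hx, hx', hv⟩ k
      have hk : k.val < n := k.2
      refine ⟨fun i ↦ if k.val + 1 = n then
          (if i = n - 2 then -x (n - 1) else if i = n - 1 then -x (n - 2) else x i)
        else if i = k then x (k + 1) else if i = k + 1 then x k else x i, fun i ↦ ?_,
        fun i j hij ↦ ?_, fun j ↦ ?_⟩
      · grind
      · grind
      · have hj : j.val < n := j.2
        simp only [hv, cartanD]
        grind
  comparable := by
    rintro ⟨i, j⟩ hb ⟨i', j'⟩ hc
    simp only [boxes, Finset.mem_filter, Finset.mem_product, Finset.mem_range,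
      Prod.mk.injEq] at hb hc
    simp only [cartanD, label]
    split_ifs <;> omega
  sum_eq := by
    refine sum_below_eq _ (by simp [cartanD]) ?_
    rintro ⟨_ | _ | i, j⟩ hb
    · rcases j with _ | j
      · refine ⟨∅, by simp, Or.inl ⟨?_, ?_⟩⟩
        · rintro ⟨i', j'⟩ hc
          simp
          omega
        · have : 0 ≠ n - 2 := by omega
          simp [weight, label, omitted, this]
      · refine ⟨{(0, j)}, ?_, Or.inl ⟨?_, ?_⟩⟩
        all_goals
          simp only [Finset.mem_singleton, forall_eq, boxes, Finset.mem_product, Finset.mem_range,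
            Finset.mem_filter, Prod.forall, cartanD, label, weight, omitted,
            Finset.sum_singleton, Prod.mk.injEq, ne_eq] at *
          grind
    · rcases eq_or_ne j (n - 3) with rfl | hj
      · refine ⟨{(0, n - 3)}, ?_, Or.inl ⟨?_, ?_⟩⟩
        all_goals
          simp only [Finset.mem_singleton, forall_eq, boxes, Finset.mem_product, Finset.mem_range,
            Finset.mem_filter, Prod.forall, cartanD, label, weight, omitted,
            Finset.sum_singleton, Prod.mk.injEq, ne_eq] at *
          grind
      -- At the fork, the labels `n` and `n - 1` separate the two boxes labelled `n - 2`.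
      · refine ⟨{(0, n - 2), (1, n - 3)}, ?_, Or.inr ⟨(0, n - 3), ?_, ?_, ?_, ?_, ?_, ?_, ?_⟩⟩
        all_goals
          try rw [Finset.sum_pair (by simp)]
          simp only [Finset.mem_insert, Finset.mem_singleton, forall_eq_or_imp, forall_eq, boxes,
            Finset.mem_product, Finset.mem_range, Finset.mem_filter, Prod.forall, cartanD, label,
            Prod.mk.injEq, ne_eq] at *
          grind
    · refine ⟨{(0, n - 3 - i), (i + 1, n - 2)}, ?_,
        Or.inr ⟨(0, n - 4 - i), ?_, ?_, ?_, ?_, ?_, ?_, ?_⟩⟩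
      all_goals
        try rw [Finset.sum_pair (by simp)]
        simp only [Finset.mem_insert, Finset.mem_singleton, forall_eq_or_imp, forall_eq, boxes,
          Finset.mem_product, Finset.mem_range, Finset.mem_filter, Prod.forall, cartanD, label,
          Prod.mk.injEq, ne_eq] at *
        grind

/-! ### Type `E` -/

/-- The Cartan matrix of type `E`. -/
def cartanE (k l : ℕ) : ℤ :=
  if k = l then 2
  else if (k, l) ∈ [(1, 3), (3, 4), (2, 4), (4, 5), (5, 6), (6, 7)] ∨
    (l, k) ∈ [(1, 3), (3, 4), (2, 4), (4, 5), (5, 6), (6, 7)] then -1 else 0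

/-- The weights of the minuscule representation of `E_6` with highest weight `ω_1`. -/
def weightsE6 : List (List ℤ) :=
  [[1, 0, 0, 0, 0, 0], [-1, 0, 1, 0, 0, 0], [0, 0, -1, 1, 0, 0], [0, 1, 0, -1, 1, 0],
   [0, -1, 0, 0, 1, 0], [0, 1, 0, 0, -1, 1], [0, -1, 0, 1, -1, 1], [0, 1, 0, 0, 0, -1],
   [0, 0, 1, -1, 0, 1], [0, -1, 0, 1, 0, -1], [1, 0, -1, 0, 0, 1], [0, 0, 1, -1, 1, -1],
   [-1, 0, 0, 0, 0, 1], [1, 0, -1, 0, 1, -1], [0, 0, 1, 0, -1, 0], [-1, 0, 0, 0, 1, -1],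
   [1, 0, -1, 1, -1, 0], [-1, 0, 0, 1, -1, 0], [1, 1, 0, -1, 0, 0], [-1, 1, 1, -1, 0, 0],
   [1, -1, 0, 0, 0, 0], [-1, -1, 1, 0, 0, 0], [0, 1, -1, 0, 0, 0], [0, -1, -1, 1, 0, 0],
   [0, 0, 0, -1, 1, 0], [0, 0, 0, 0, -1, 1], [0, 0, 0, 0, 0, -1]]

/-- The weights of the minuscule representation of `E_7` with highest weight `ω_7`. -/
def weightsE7 : List (List ℤ) :=
  [[0, 0, 0, 0, 0, 0, 1], [0, 0, 0, 0, 0, 1, -1], [0, 0, 0, 0, 1, -1, 0], [0, 0, 0, 1, -1, 0, 0],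
   [0, 1, 1, -1, 0, 0, 0], [0, -1, 1, 0, 0, 0, 0], [1, 1, -1, 0, 0, 0, 0], [1, -1, -1, 1, 0, 0, 0],
   [-1, 1, 0, 0, 0, 0, 0], [-1, -1, 0, 1, 0, 0, 0], [1, 0, 0, -1, 1, 0, 0],
   [-1, 0, 1, -1, 1, 0, 0], [1, 0, 0, 0, -1, 1, 0], [0, 0, -1, 0, 1, 0, 0],
   [-1, 0, 1, 0, -1, 1, 0], [1, 0, 0, 0, 0, -1, 1], [0, 0, -1, 1, -1, 1, 0],
   [-1, 0, 1, 0, 0, -1, 1], [1, 0, 0, 0, 0, 0, -1], [0, 1, 0, -1, 0, 1, 0],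
   [0, 0, -1, 1, 0, -1, 1], [-1, 0, 1, 0, 0, 0, -1], [0, -1, 0, 0, 0, 1, 0],
   [0, 1, 0, -1, 1, -1, 1], [0, 0, -1, 1, 0, 0, -1], [0, -1, 0, 0, 1, -1, 1],
   [0, 1, 0, 0, -1, 0, 1], [0, 1, 0, -1, 1, 0, -1], [0, -1, 0, 1, -1, 0, 1],
   [0, -1, 0, 0, 1, 0, -1], [0, 1, 0, 0, -1, 1, -1], [0, 0, 1, -1, 0, 0, 1],
   [0, -1, 0, 1, -1, 1, -1], [0, 1, 0, 0, 0, -1, 0], [1, 0, -1, 0, 0, 0, 1],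
   [0, 0, 1, -1, 0, 1, -1], [0, -1, 0, 1, 0, -1, 0], [-1, 0, 0, 0, 0, 0, 1],
   [1, 0, -1, 0, 0, 1, -1], [0, 0, 1, -1, 1, -1, 0], [-1, 0, 0, 0, 0, 1, -1],
   [1, 0, -1, 0, 1, -1, 0], [0, 0, 1, 0, -1, 0, 0], [-1, 0, 0, 0, 1, -1, 0],
   [1, 0, -1, 1, -1, 0, 0], [-1, 0, 0, 1, -1, 0, 0], [1, 1, 0, -1, 0, 0, 0],
   [-1, 1, 1, -1, 0, 0, 0], [1, -1, 0, 0, 0, 0, 0], [-1, -1, 1, 0, 0, 0, 0],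
   [0, 1, -1, 0, 0, 0, 0], [0, -1, -1, 1, 0, 0, 0], [0, 0, 0, -1, 1, 0, 0], [0, 0, 0, 0, -1, 1, 0],
   [0, 0, 0, 0, 0, -1, 1], [0, 0, 0, 0, 0, 0, -1]]

/-- A finite criterion for `IsMinuscule`. -/
theorem isMinuscule_of_list {n : ℕ} {a : Fin n → Fin n → ℤ} {ω : Fin n → ℤ} (L : List (List ℤ))
    (hω : ∃ v ∈ L, ∀ k : Fin n, ω k = v.getD k 0)
    (hle : ∀ v ∈ L, ∀ k : Fin n, v.getD k 0 ≤ 1)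
    (hr : ∀ v ∈ L, ∀ k : Fin n, ∃ v' ∈ L, ∀ j : Fin n,
      v.getD j 0 - v.getD k 0 * a k j = v'.getD j 0) : IsMinuscule a ω := by
  refine ⟨{v | ∃ v' ∈ L, ∀ k : Fin n, v k = v'.getD k 0}, hω, ?_, ?_⟩
  · rintro v ⟨v', hv', hv⟩ k
    rw [hv]
    exact hle v' hv' k
  · rintro v ⟨v', hv', hv⟩ k
    obtain ⟨v'', hv'', h⟩ := hr v' hv' k
    exact ⟨v'', hv'', fun j ↦ by simp only [hv, h]⟩

theorem isCartanMatrixOf_E6 :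
    IsCartanMatrixOf CoxeterMatrix.E₆ fun i j ↦ cartanE (i + 1) (j + 1) := by
  intro i j
  fin_cases i <;> fin_cases j <;> decide +kernel

theorem isMinusculeHeap_E6 : E6.IsMinusculeHeap cartanE where
  cartan := isCartanMatrixOf_E6
  -- The three checks are that `ω` is listed, that entries are at most `1`, and that reflections
  -- preserve the list.
  minuscule := isMinuscule_of_list (n := 6) weightsE6 (by decide +kernel) (by decide +kernel)
    (by decide +kernel)
  comparable := by decide +kernel
  sum_eq := by decide +kernel

theorem isCartanMatrixOf_E7 :
    IsCartanMatrixOf CoxeterMatrix.E₇ fun i j ↦ cartanE (i + 1) (j + 1) := by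
  intro i j
  fin_cases i <;> fin_cases j <;> decide +kernel

theorem isMinusculeHeap_E7 : E7.IsMinusculeHeap cartanE where
  cartan := isCartanMatrixOf_E7
  minuscule := isMinuscule_of_list (n := 7) weightsE7 (by decide +kernel) (by decide +kernel)
    (by decide +kernel)
  comparable := by decide +kernel
  sum_eq := by decide +kernel

end HermitianType

theorem mainTheorem4 (t : HermitianType) {W : Type*} [Group W]
    (cs : CoxeterSystem t.coxeterMatrix W) (u : W) (s : Fin t.rank) (Λ M : Finset (ℕ × ℕ))
    (hu : u ∈ t.minReps cs) (hΛ : t.IsDiagramOf cs Λ u)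
    (hsu : cs.simple s * u ∈ t.minReps cs) (hM : t.IsDiagramOf cs M (cs.simple s * u)) :
    (cs.IsLeftDescent u s ↔ ∃ b, Λ \ M = {b} ∧ IsOutsideCorner Λ b) ∧
      (¬ cs.IsLeftDescent u s → ∃ b, M \ Λ = {b} ∧ IsOutsideCorner M b) := by
  cases t with
  | A n p hp hpn => exact (HermitianType.isMinusculeHeap_A n p hp hpn).isLeftDescent_iff cs hΛ hM
  | C n hn => exact (HermitianType.isMinusculeHeap_C n hn).isLeftDescent_iff cs hΛ hM
  | B n hn => exact (HermitianType.isMinusculeHeap_B n hn).isLeftDescent_iff cs hΛ hM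
  | DA n hn => exact (HermitianType.isMinusculeHeap_DA n hn).isLeftDescent_iff cs hΛ hM
  | DD n hn => exact (HermitianType.isMinusculeHeap_DD n hn).isLeftDescent_iff cs hΛ hM
  | E6 => exact HermitianType.isMinusculeHeap_E6.isLeftDescent_iff cs hΛ hM
  | E7 => exact HermitianType.isMinusculeHeap_E7.isLeftDescent_iff cs hΛ hM
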